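/- Let $\{S(t):t\ge 0\}$ be a real-valued Lévy process whose function $\kappa_S(\theta):=\log\mathbb{E}[e^{\theta S(1)}]$ is finite in a neighborhood of $\theta=0$. Assume that $\{S(t)\}$ has bounded variation and is not a subordinator, and let $\{S_1(t):t\ge 0\}$ and $\{S_2(t):t\ge 0\}$ be two independent non-null subordinators such that $\{S(t):t\ge 0\}$ is distributed as $\{S_1(t)-S_2(t):t\ge 0\}$. Put $\kappa_{S_i}(\theta):=\log\mathbb{E}[e^{\theta S_i(1)}]\in(-\infty,\infty]$ for $i=1,2$. For $i=1,2$ let $\{L_{f_i}^{(i)}(t):t\ge 0\}$ be a nonnegative process such that, for every $\rho\in\mathbb{R}$, $$\lim_{t\to\infty}\frac1t\log\mathbb{E}\left[e^{\rho L_{f_i}^{(i)}(t)}\right]=\begin{cases} f_i(\rho)&\text{if }\rho\ge 0,\\ 0&\text{if }\rho<0,\end{cases}$$ where $f_i:[0,\infty)\to\mathbb{R}$ is a convex non-decreasing function with $f_i(0)=0$ and right derivative $f_i'(0)=0$. Assume that the processes $S_1$, $S_2$, $L_{f_1}^{(1)}$, $L_{f_2}^{(2)}$ are independent. Let $$\Psi_{f_1,f_2}(\theta):=\begin{cases}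 f_1(\kappa_{S_1}(\theta))&\text{if }\theta\ge 0,\\ f_2(\kappa_{S_2}(-\theta))&\text{if }\theta<0,\end{cases}$$ with the convention $f_i(\infty)=\infty$. Assume that $\Psi_{f_1,f_2}$ is essentially smooth, that is: with $\mathcal{D}:=\{\theta\in\mathbb{R}:\Psi_{f_1,f_2}(\theta)<\infty\}$, the interior of $\mathcal{D}$ is non-empty, $\Psi_{f_1,f_2}$ is differentiable on it, and $|\Psi_{f_1,f_2}'(\theta_n)|\to\infty$ for every sequence $(\theta_n)$ in the interior of $\mathcal{D}$ that converges to a boundary point of $\mathcal{D}$. Then, with $Z(t):=\frac{S_1(L_{f_1}^{(1)}(t))-S_2(L_{f_2}^{(2)}(t))}{t}$, the family $\{Z(t):t>0\}$ satisfies the large deviation principle with speed $t$ and rate function $$J_{\mathrm{LD},f_1,f_2}(x):=\sup_{\theta\in\mathbb{R}}\{\theta x-\Psi_{f_1,f_2}(\theta)\},$$ and this rate function is good. That is, $J_{\mathrm{LD},f_1,f_2}:\mathbb{R}\to[0,\infty]$ is lower semicontinuous with compact level sets $\{J_{\mathrm{LD},f_1,f_2}\le\beta\}$, $\beta\ge0$,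 and $$\limsup_{t\to\infty}\frac1t\log P(Z(t)\in C)\le-\inf_{x\in C}J_{\mathrm{LD},f_1,f_2}(x)\quad\text{for all closed sets }C\subseteq\mathbb{R},$$ $$\liminf_{t\to\infty}\frac1t\log P(Z(t)\in O)\ge-\inf_{x\in O}J_{\mathrm{LD},f_1,f_2}(x)\quad\text{for all open sets }O\subseteq\mathbb{R}.$$ -/

import Mathlib

open MeasureTheory ProbabilityTheory Filter Set
open scoped NNReal ENNReal Topology

noncomputable section

namespace TimeChangeLDP

/-- A real-valued Lévy process: it starts at `0`, has independent and stationary increments, is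
stochastically continuous, and has almost surely càdlàg paths. -/
structure IsLevyProcess {Ω : Type*} [MeasurableSpace Ω] (X : ℝ≥0 → Ω → ℝ) (P : Measure Ω) :
    Prop where
  measurable : ∀ t, Measurable (X t)
  zero : ∀ᵐ ω ∂P, X 0 ω = 0
  indepIncrements : HasIndepIncrements X P
  stationaryIncrements : ∀ s t, IdentDistrib (fun ω => X (s + t) ω - X s ω) (X t) P P
  stochContinuous : ∀ t, TendstoInMeasure P X (𝓝 t) (X t)
  cadlag : ∀ᵐ ω ∂P, ∀ t, ContinuousWithinAt (fun s => X s ω) (Ioi t) t ∧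
    ∃ l : ℝ, Tendsto (fun s => X s ω) (𝓝[<] t) (𝓝 l)

/-- A subordinator: a Lévy process with almost surely nondecreasing paths. -/
structure IsSubordinator {Ω : Type*} [MeasurableSpace Ω] (X : ℝ≥0 → Ω → ℝ) (P : Measure Ω) :
    Prop extends IsLevyProcess X P where
  monotone : ∀ᵐ ω ∂P, Monotone (fun t => X t ω)

/-- Almost every path has bounded variation on every compact time interval. -/
def HasBVPaths {Ω : Type*} [MeasurableSpace Ω] (X : ℝ≥0 → Ω → ℝ) (P : Measure Ω) : Prop :=
  ∀ᵐ ω ∂P, LocallyBoundedVariationOn (fun t => X t ω) univ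

/-- The process is almost surely identically zero. -/
def IsNull {Ω : Type*} [MeasurableSpace Ω] (X : ℝ≥0 → Ω → ℝ) (P : Measure Ω) : Prop :=
  ∀ᵐ ω ∂P, ∀ t, X t ω = 0

/-- The extended logarithmic moment generating function `θ ↦ log 𝔼[exp (θ Y)]`; it is `⊤` where
the expectation is infinite. -/
def logMGF {Ω : Type*} [MeasurableSpace Ω] (Y : Ω → ℝ) (P : Measure Ω) (θ : ℝ) : EReal :=
  ENNReal.log (∫⁻ ω, ENNReal.ofReal (Real.exp (θ * Y ω)) ∂P)

/-- The process is light-tailed: `log 𝔼[exp (θ X(1))]` is finite for `θ` near `0`. -/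
def IsLightTailed {Ω : Type*} [MeasurableSpace Ω] (X : ℝ≥0 → Ω → ℝ) (P : Measure Ω) : Prop :=
  ∀ᶠ θ in 𝓝 (0 : ℝ), logMGF (X 1) P θ < ⊤

/-- The function equal to `f ρ` for `ρ ≥ 0` and to `0` for `ρ < 0`. -/
def upsilon (f : ℝ → ℝ) (ρ : ℝ) : ℝ := if 0 ≤ ρ then f ρ else 0

/-- The nonnegative process `L` is a random time-change with limiting log-moment generating
function `upsilon f`, where `f` is convex and nondecreasing on `[0, ∞)` with `f 0 = 0` and right
derivative `0` at the origin. Only the values of `f` on `[0, ∞)` matter. -/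
structure IsTimeChange {Ω : Type*} [MeasurableSpace Ω] (L : ℝ≥0 → Ω → ℝ≥0) (f : ℝ → ℝ)
    (P : Measure Ω) : Prop where
  measurable : ∀ t, Measurable (L t)
  convex : ConvexOn ℝ (Ici 0) f
  monotone : MonotoneOn f (Ici 0)
  map_zero : f 0 = 0
  deriv_zero : HasDerivWithinAt f 0 (Ici 0) 0
  tendsto_logMGF : ∀ ρ : ℝ,
    Tendsto (fun t : ℝ≥0 => logMGF (fun ω => (L t ω : ℝ)) P ρ / ((t : ℝ) : EReal)) atTop
      (𝓝 ((upsilon f ρ : ℝ) : EReal))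

/-- Extension of a function `f` on `[0, ∞)` to extended arguments, with `f ∞ = ∞`. (The value at
`⊥` is immaterial.) -/
def extendTop (f : ℝ → ℝ) (x : EReal) : EReal :=
  if x = ⊤ then ⊤ else ((f x.toReal : ℝ) : EReal)

/-- The function `θ ↦ f₁ (κ_{S₁} θ)` for `θ ≥ 0` and `θ ↦ f₂ (κ_{S₂} (-θ))` for `θ < 0`, where
`κ_{Sᵢ} θ = log 𝔼[exp (θ Sᵢ(1))]`. -/
def Psi {Ω : Type*} [MeasurableSpace Ω] (f₁ f₂ : ℝ → ℝ) (S₁ S₂ : ℝ≥0 → Ω → ℝ) (P : Measure Ω)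
    (θ : ℝ) : EReal :=
  if 0 ≤ θ then extendTop f₁ (logMGF (S₁ 1) P θ) else extendTop f₂ (logMGF (S₂ 1) P (-θ))

/-- The effective domain `{θ | Λ θ < ∞}`. -/
def effDomain (Λ : ℝ → EReal) : Set ℝ := {θ | Λ θ < ⊤}

/-- Essential smoothness of `Λ : ℝ → (-∞, ∞]`: the interior of the effective domain is nonempty,
`Λ` is differentiable there, and `Λ` is steep. -/
structure EssentiallySmooth (Λ : ℝ → EReal) : Prop where
  ne_bot : ∀ θ, Λ θ ≠ ⊥
  nonempty_interior : (interior (effDomain Λ)).Nonempty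
  differentiable : ∀ θ ∈ interior (effDomain Λ), DifferentiableAt ℝ (fun x => (Λ x).toReal) θ
  steep : ∀ (u : ℕ → ℝ) (a : ℝ), (∀ n, u n ∈ interior (effDomain Λ)) →
    a ∈ frontier (effDomain Λ) → Tendsto u atTop (𝓝 a) →
    Tendsto (fun n => |deriv (fun x => (Λ x).toReal) (u n)|) atTop atTop

/-- The Legendre transform `x ↦ sup_θ (θ x - Λ θ)`. -/
def legendre (Λ : ℝ → EReal) (x : ℝ) : EReal :=
  ⨆ θ : ℝ, (((θ * x : ℝ) : EReal) - Λ θ)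

/-- A good rate function on `ℝ`: lower semicontinuous, with values in `[0, ∞]` and compact level
sets. -/
structure IsGoodRateFunction (I : ℝ → EReal) : Prop where
  lowerSemicontinuous : LowerSemicontinuous I
  nonneg : ∀ x, 0 ≤ I x
  isCompact_le : ∀ β : ℝ, 0 ≤ β → IsCompact {x | I x ≤ (β : EReal)}

/-- The family `Z t`, as `t → ∞`, satisfies the large deviation bounds with speed `v` and rate
`I`. -/
structure SatisfiesLDP {Ω : Type*} [MeasurableSpace Ω] (Z : ℝ≥0 → Ω → ℝ) (P : Measure Ω)
    (v : ℝ≥0 → ℝ) (I : ℝ → EReal) : Prop where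
  speed : Tendsto v atTop atTop
  upper : ∀ C : Set ℝ, IsClosed C →
    limsup (fun t => ENNReal.log (P {ω | Z t ω ∈ C}) / (v t : EReal)) atTop ≤ -⨅ x ∈ C, I x
  lower : ∀ O : Set ℝ, IsOpen O →
    -⨅ x ∈ O, I x ≤ liminf (fun t => ENNReal.log (P {ω | Z t ω ∈ O}) / (v t : EReal)) atTop

end TimeChangeLDP

end

/-!
The theorem is the Gärtner–Ellis theorem applied to `W t = S₁ (L₁ t) - S₂ (L₂ t)`, and both halves,
the limit of the logarithmic moment generating functions and the passage to the large deviation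
principle, are elementary here.

*The limit.* Let `θ ≥ 0`, so that `κ₁ = log 𝔼[exp (θ S₁(1))] ≥ 0` and
`κ₂ = log 𝔼[exp (-θ S₂(1))] ≤ 0`. By independent stationary increments,
`𝔼[exp (θ S₁(N))] = 𝔼[exp (κ₁ N)]` for an independent integer time `N`
(`IsLevyProcess.emgf_eval_nat`). Paths are monotone, so `S₁ (L₁ t)` lies between the values of `S₁`
at `⌊L₁ t⌋` and `⌊L₁ t⌋ + 1`, and rounding costs only the factor `exp κ₁`, which does not depend on
`t`. The factor coming from `S₂` is at most `1` and, since `κ₂ ≤ 0`, has rate `0`. This gives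
`TimeChangedPair.emgf_le` and `TimeChangedPair.le_emgf`, and hence the limit `Ψ θ` wherever `Ψ` is
finite; no lower bound is needed elsewhere. The case `θ ≤ 0` follows by exchanging the indices.

*The large deviation principle.* The function `Ψ` vanishes at `0` and is monotone on either side of
it (`IsValley`), which makes convexity unnecessary. A closed set avoiding `0` is contained in at
most two half-lines pointing away from `0` with end points in the set, to which Chernoff's bound
applies (`HasLimitingLogMGF.upper_bound`). For the lower bound at `x > 0` with finite rate, every `y` in
`[0, x)` is a slope `Ψ' θ`, by Darboux's theorem and steepness (`IsValley.exists_deriv_eq`), and has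
rate at most that of `x`; tilting by `exp (θ W t)` gives the lower bound at `y`
(`HasLimitingLogMGF.le_measure_window`). Goodness of the rate function holds because `Ψ` is finite
near `0`, which comes from the light tails of `S`.
-/

namespace TimeChangeLDP

/-! ### Exponential rates -/

theorem log_div_le_iff {a : ℝ≥0∞} {t c : ℝ} (ht : 0 < t) :
    ENNReal.log a / (t : EReal) ≤ c ↔ a ≤ ENNReal.ofReal (Real.exp (c * t)) := by
  rw [EReal.div_le_iff_le_mul (by exact_mod_cast ht) (EReal.coe_ne_top t),
    ← ENNReal.log_le_log_iff, ENNReal.log_ofReal_of_pos (Real.exp_pos _), Real.log_exp,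
    mul_comm c t, EReal.coe_mul]

theorem le_log_div_iff {a : ℝ≥0∞} {t c : ℝ} (ht : 0 < t) :
    (c : EReal) ≤ ENNReal.log a / (t : EReal) ↔ ENNReal.ofReal (Real.exp (c * t)) ≤ a := by
  rw [EReal.le_div_iff_mul_le (by exact_mod_cast ht) (EReal.coe_ne_top t),
    ← ENNReal.log_le_log_iff, ENNReal.log_ofReal_of_pos (Real.exp_pos _), Real.log_exp,
    EReal.coe_mul]

theorem eventually_pos_atTop : ∀ᶠ t : ℝ≥0 in atTop, 0 < (t : ℝ) := by
  filter_upwards [eventually_gt_atTop (0 : ℝ≥0)] with t ht using ht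

theorem limsup_log_div_le {a : ℝ≥0 → ℝ≥0∞} {x : EReal}
    (h : ∀ c : ℝ, x < c → ∀ᶠ t : ℝ≥0 in atTop, a t ≤ ENNReal.ofReal (Real.exp (c * t))) :
    limsup (fun t : ℝ≥0 => ENNReal.log (a t) / ((t : ℝ) : EReal)) atTop ≤ x := by
  rw [limsup_le_iff']
  intro y hy
  obtain ⟨c, hc, hcy⟩ := EReal.lt_iff_exists_real_btwn.1 hy
  filter_upwards [h c hc, eventually_pos_atTop] with t ht ht0
  exact ((log_div_le_iff ht0).2 ht).trans hcy.le

theorem le_liminf_log_div {a : ℝ≥0 → ℝ≥0∞} {x : EReal}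
    (h : ∀ c : ℝ, (c : EReal) < x → ∀ᶠ t : ℝ≥0 in atTop, ENNReal.ofReal (Real.exp (c * t)) ≤ a t) :
    x ≤ liminf (fun t : ℝ≥0 => ENNReal.log (a t) / ((t : ℝ) : EReal)) atTop := by
  rw [le_liminf_iff']
  intro y hy
  obtain ⟨c, hyc, hc⟩ := EReal.lt_iff_exists_real_btwn.1 hy
  filter_upwards [h c hc, eventually_pos_atTop] with t ht ht0
  exact hyc.le.trans ((le_log_div_iff ht0).2 ht)

/-- A constant factor does not affect an exponential rate. -/
theorem eventually_mul_exp_le (K : ℝ) {c c' : ℝ} (h : c < c') :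
    ∀ᶠ t : ℝ≥0 in atTop, K * Real.exp (c * t) ≤ Real.exp (c' * t) := by
  have h1 : Tendsto (fun t : ℝ≥0 => Real.exp ((c' - c) * t)) atTop atTop :=
    Real.tendsto_exp_atTop.comp
      ((NNReal.tendsto_coe_atTop.2 tendsto_id).const_mul_atTop (sub_pos.2 h))
  filter_upwards [h1.eventually_ge_atTop K] with t ht
  calc K * Real.exp (c * t) ≤ Real.exp ((c' - c) * t) * Real.exp (c * t) := by gcongr
    _ = Real.exp (c' * t) := by rw [← Real.exp_add]; ring_nf

/-- The moment generating function `θ ↦ 𝔼[exp (θ Y)]`, with values in `[0, ∞]`. -/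
noncomputable def emgf {Ω : Type*} [MeasurableSpace Ω] (Y : Ω → ℝ) (P : Measure Ω) (θ : ℝ) :
    ℝ≥0∞ :=
  ∫⁻ ω, ENNReal.ofReal (Real.exp (θ * Y ω)) ∂P

theorem log_emgf {Ω : Type*} [MeasurableSpace Ω] (Y : Ω → ℝ) (P : Measure Ω) (θ : ℝ) :
    ENNReal.log (emgf Y P θ) = logMGF Y P θ := rfl

theorem emgf_neg {Ω : Type*} [MeasurableSpace Ω] (Y : Ω → ℝ) (P : Measure Ω) (θ : ℝ) :
    emgf (fun ω => -Y ω) P θ = emgf Y P (-θ) := by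
  simp [emgf]

/-! ### Shape of the limiting logarithmic moment generating function -/

/-- `Λ` vanishes at `0`, is monotone on `[0, ∞)` and antitone on `(-∞, 0]`. In the one-dimensional
Gärtner–Ellis theorem this replaces convexity. -/
structure IsValley (Λ : ℝ → EReal) : Prop where
  map_zero : Λ 0 = 0
  monotoneOn : MonotoneOn Λ (Ici 0)
  antitoneOn : AntitoneOn Λ (Iic 0)

variable {Λ : ℝ → EReal}

theorem IsValley.nonneg (h : IsValley Λ) (θ : ℝ) : 0 ≤ Λ θ := by
  rw [← h.map_zero]
  rcases le_total 0 θ with h0 | h0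
  · exact h.monotoneOn (mem_Ici.2 le_rfl) h0 h0
  · exact h.antitoneOn h0 (mem_Iic.2 le_rfl) h0

theorem IsValley.neg (h : IsValley Λ) : IsValley (fun θ => Λ (-θ)) where
  map_zero := by simp [h.map_zero]
  monotoneOn a ha b hb hab := h.antitoneOn (by simpa using hb) (by simpa using ha) (by simpa)
  antitoneOn a ha b hb hab := h.monotoneOn (by simpa using hb) (by simpa using ha) (by simpa)

theorem IsValley.coe_toReal (h : IsValley Λ) {θ : ℝ} (hθ : θ ∈ effDomain Λ) :
    (((Λ θ).toReal : ℝ) : EReal) = Λ θ :=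
  EReal.coe_toReal hθ.ne (ne_bot_of_le_ne_bot EReal.zero_ne_bot (h.nonneg θ))

theorem effDomain_neg (Λ : ℝ → EReal) : effDomain (fun θ => Λ (-θ)) = Neg.neg ⁻¹' effDomain Λ :=
  rfl

theorem interior_effDomain_neg (Λ : ℝ → EReal) :
    interior (effDomain (fun θ => Λ (-θ))) = Neg.neg ⁻¹' interior (effDomain Λ) :=
  ((Homeomorph.neg ℝ).preimage_interior (effDomain Λ)).symm

theorem EssentiallySmooth.neg (h : EssentiallySmooth Λ) :
    EssentiallySmooth (fun θ => Λ (-θ)) where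
  ne_bot θ := h.ne_bot _
  nonempty_interior := by
    obtain ⟨θ, hθ⟩ := h.nonempty_interior
    exact ⟨-θ, by simpa [interior_effDomain_neg] using hθ⟩
  differentiable θ hθ := by
    rw [interior_effDomain_neg] at hθ
    exact (h.differentiable _ hθ).comp θ differentiableAt_id.neg
  steep u a hu ha hua := by
    have ha' : -a ∈ frontier (effDomain Λ) := by
      rw [effDomain_neg] at ha
      exact (congrArg (a ∈ ·) ((Homeomorph.neg ℝ).preimage_frontier (effDomain Λ))).mpr ha
    refine (h.steep (fun n => -u n) (-a)
      (fun n => by have := hu n; rwa [interior_effDomain_neg] at this)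
      ha' hua.neg).congr fun n => ?_
    rw [deriv_comp_neg (fun x => (Λ x).toReal), abs_neg]

theorem legendre_neg (Λ : ℝ → EReal) (x : ℝ) :
    legendre (fun θ => Λ (-θ)) x = legendre Λ (-x) := by
  unfold legendre
  refine (Equiv.neg ℝ).iSup_congr fun θ => ?_
  simp

theorem IsValley.legendre_nonneg (h : IsValley Λ) (x : ℝ) : 0 ≤ legendre Λ x :=
  le_iSup_of_le 0 (by simp [h.map_zero])

theorem IsValley.legendre_le_legendre (h : IsValley Λ) {x y : ℝ} (hy : 0 ≤ y) (hyx : y ≤ x) :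
    legendre Λ y ≤ legendre Λ x := by
  refine iSup_le fun θ => ?_
  rcases le_total 0 θ with h0 | h0
  · refine le_iSup_of_le θ (EReal.sub_le_sub ?_ le_rfl)
    exact_mod_cast mul_le_mul_of_nonneg_left hyx h0
  · refine le_trans ?_ (h.legendre_nonneg x)
    rw [EReal.sub_nonpos]
    exact le_trans (by exact_mod_cast mul_nonpos_of_nonpos_of_nonneg h0 hy) (h.nonneg θ)

theorem IsValley.mem_effDomain_of_le (h : IsValley Λ) {θ d : ℝ} (hd : d ∈ effDomain Λ)
    (h0 : 0 ≤ θ) (hθ : θ ≤ d) : θ ∈ effDomain Λ :=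
  (h.monotoneOn h0 (h0.trans hθ) hθ).trans_lt hd

theorem IsValley.mem_interior (h : IsValley Λ) {θ d : ℝ} (hd : d ∈ effDomain Λ)
    (h0 : 0 < θ) (hθ : θ < d) : θ ∈ interior (effDomain Λ) :=
  interior_maximal (fun _ hx => h.mem_effDomain_of_le hd hx.1.le hx.2.le) isOpen_Ioo ⟨h0, hθ⟩

theorem IsValley.deriv_zero (h : IsValley Λ) : deriv (fun θ => (Λ θ).toReal) 0 = 0 := by
  refine IsLocalMin.deriv_eq_zero (Eventually.of_forall fun θ => ?_)
  simpa [h.map_zero] using EReal.toReal_nonneg (h.nonneg θ)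

theorem IsValley.deriv_nonneg (h : IsValley Λ) {θ d : ℝ} (hd : d ∈ effDomain Λ)
    (h0 : 0 < θ) (hθ : θ < d) : 0 ≤ deriv (fun θ => (Λ θ).toReal) θ := by
  have hmono : MonotoneOn (fun θ => (Λ θ).toReal) (Ioo 0 d) := fun a ha b hb hab =>
    EReal.toReal_le_toReal (h.monotoneOn ha.1.le hb.1.le hab)
      (ne_bot_of_le_ne_bot EReal.zero_ne_bot (h.nonneg a))
      (h.mem_effDomain_of_le hd hb.1.le hb.2.le).ne
  rw [← derivWithin_of_isOpen isOpen_Ioo ⟨h0, hθ⟩]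
  exact hmono.derivWithin_nonneg

/-- Below a point where the Legendre transform is finite, every slope is attained. By Darboux's
theorem, if the slope `y` is skipped then the derivative stays in `[0, y]`; this is excluded by
steepness when the effective domain is bounded above, and otherwise forces the Legendre transform
to be infinite beyond `y`. -/
theorem IsValley.exists_deriv_eq (h : IsValley Λ) (hs : EssentiallySmooth Λ)
    (h0 : (0 : ℝ) ∈ interior (effDomain Λ)) {x y : ℝ} (hy : 0 ≤ y) (hyx : y < x)
    (hx : legendre Λ x < ⊤) :
    ∃ θ ∈ interior (effDomain Λ), deriv (fun θ => (Λ θ).toReal) θ = y := by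
  by_contra! hne
  set g : ℝ → ℝ := fun θ => (Λ θ).toReal with hg
  have hle : ∀ d ∈ effDomain Λ, ∀ θ, 0 < θ → θ < d → deriv g θ ≤ y := by
    intro d hd θ hθ0 hθd
    by_contra! hlt
    have hsub : ∀ z ∈ Icc 0 θ, z ∈ interior (effDomain Λ) := by
      intro z hz
      rcases hz.1.eq_or_lt with rfl | hz0
      · exact h0
      · exact h.mem_interior hd hz0 (hz.2.trans_lt hθd)
    obtain ⟨z, hz, hzy⟩ := exists_hasDerivWithinAt_eq_of_ge_of_le hθ0.le
      (fun z hz => (hs.differentiable z (hsub z hz)).hasDerivAt.hasDerivWithinAt)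
      (m := y) (h.deriv_zero.trans_le hy) hlt.le
    exact hne z (hsub z hz) hzy
  obtain ⟨ε, hε, hball⟩ := Metric.isOpen_iff.1 isOpen_interior 0 h0
  have hεD : ε / 2 ∈ effDomain Λ := interior_subset (hball (by
    rw [Metric.mem_ball, Real.dist_eq, sub_zero, abs_of_pos (by positivity)]; linarith))
  by_cases hbdd : BddAbove (effDomain Λ)
  · set b := sSup (effDomain Λ)
    have hlub : IsLUB (effDomain Λ) b := isLUB_csSup ⟨_, hεD⟩ hbdd
    have hb : 0 < b := (half_pos hε).trans_le (hlub.1 hεD)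
    set u : ℕ → ℝ := fun n => b - b / 2 * (1 / ((n : ℝ) + 1)) with hu
    have hu0 : ∀ n, 0 < u n ∧ u n < b := by
      intro n
      have h1 : 0 < 1 / ((n : ℝ) + 1) := by positivity
      have h2 : 1 / ((n : ℝ) + 1) ≤ 1 := by
        rw [div_le_one (by positivity)]; linarith [(Nat.cast_nonneg n : (0 : ℝ) ≤ n)]
      constructor <;> simp only [hu] <;> nlinarith
    have hd : ∀ n, ∃ d ∈ effDomain Λ, u n < d := fun n => (lt_isLUB_iff hlub).1 (hu0 n).2
    have hfront : b ∈ frontier (effDomain Λ) := by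
      refine ⟨hlub.mem_closure ⟨_, hεD⟩, fun hbi => ?_⟩
      obtain ⟨r, hr, hrb⟩ := Metric.isOpen_iff.1 isOpen_interior b hbi
      have : b + r / 2 ∈ effDomain Λ := interior_subset (hrb (by
        rw [Metric.mem_ball, Real.dist_eq, add_sub_cancel_left, abs_of_pos (by positivity)]
        linarith))
      linarith [hlub.1 this]
    have hlim : Tendsto u atTop (𝓝 b) := by
      simpa [hu] using (tendsto_one_div_add_atTop_nhds_zero_nat.const_mul (b / 2)).const_sub b
    have hst := hs.steep u b (fun n => by
      obtain ⟨d, hdD, hud⟩ := hd n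
      exact h.mem_interior hdD (hu0 n).1 hud) hfront hlim
    obtain ⟨n, hn⟩ := (hst.eventually_gt_atTop y).exists
    obtain ⟨d, hdD, hud⟩ := hd n
    rw [abs_of_nonneg (h.deriv_nonneg hdD (hu0 n).1 hud)] at hn
    exact absurd (hle d hdD _ (hu0 n).1 hud) (not_le.2 hn)
  · rw [not_bddAbove_iff] at hbdd
    have hD : ∀ θ, 0 ≤ θ → θ ∈ effDomain Λ := fun θ hθ => by
      obtain ⟨d, hdD, hθd⟩ := hbdd θ
      exact h.mem_effDomain_of_le hdD hθ hθd.le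
    have hint : ∀ θ, 0 ≤ θ → θ ∈ interior (effDomain Λ) := fun θ hθ => by
      rcases hθ.eq_or_lt with rfl | hθ
      · exact h0
      · exact h.mem_interior (hD (θ + 1) (by linarith)) hθ (by linarith)
    have hlin : ∀ θ, 0 ≤ θ → g θ ≤ y * θ := by
      intro θ hθ
      have := (convex_Ici (0 : ℝ)).image_sub_le_mul_sub_of_deriv_le (f := g) (C := y)
        (fun z hz => (hs.differentiable z (hint z hz)).continuousAt.continuousWithinAt)
        (fun z hz => by
          rw [interior_Ici] at hz
          exact (hs.differentiable z (hint z (le_of_lt hz))).differentiableWithinAt)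
        (fun z hz => by
          rw [interior_Ici] at hz
          exact hle (z + 1) (hD _ (by linarith [mem_Ioi.1 hz])) z hz (by linarith))
        0 (mem_Ici.2 le_rfl) θ hθ hθ
      have hg0 : g 0 = 0 := by simp [hg, h.map_zero]
      rw [hg0] at this
      linarith
    obtain ⟨j, hj⟩ : ∃ j : ℝ, legendre Λ x = j :=
      ⟨_, (EReal.coe_toReal hx.ne
        (ne_bot_of_le_ne_bot EReal.zero_ne_bot (h.legendre_nonneg x))).symm⟩
    have hj0 : 0 ≤ j := by exact_mod_cast hj ▸ h.legendre_nonneg x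
    have hxy := sub_pos.2 hyx
    have hθ : 0 ≤ (j + 1) / (x - y) := by positivity
    have h1 : (((j + 1) / (x - y) * x : ℝ) : EReal) - Λ ((j + 1) / (x - y)) ≤ legendre Λ x :=
      le_iSup (fun θ : ℝ => ((θ * x : ℝ) : EReal) - Λ θ) _
    rw [hj, ← h.coe_toReal (hD _ hθ), ← EReal.coe_sub, EReal.coe_le_coe_iff] at h1
    have h2 := hlin _ hθ
    have h3 : (j + 1) / (x - y) * (x - y) = j + 1 := by field_simp
    simp only [hg] at h2
    nlinarith

/-- The Legendre transform is a good rate function: it grows at least linearly, since `Λ` is finite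
on both sides of the origin. -/
theorem IsValley.isGoodRateFunction (h : IsValley Λ) (h0 : (0 : ℝ) ∈ interior (effDomain Λ)) :
    IsGoodRateFunction (legendre Λ) := by
  have hlsc : LowerSemicontinuous (legendre Λ) := by
    refine lowerSemicontinuous_iSup fun θ => Continuous.lowerSemicontinuous ?_
    have hc : Continuous fun x : ℝ => ((θ * x : ℝ) : EReal) :=
      continuous_coe_real_ereal.comp (continuous_const.mul continuous_id)
    rcases eq_or_ne (Λ θ) ⊤ with ht | ht
    · simpa [ht] using continuous_const
    · have := h.coe_toReal (lt_top_iff_ne_top.2 ht)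
      rw [← this]
      simp_rw [← EReal.coe_sub]
      exact continuous_coe_real_ereal.comp
        ((continuous_const.mul continuous_id).sub continuous_const)
  refine ⟨hlsc, h.legendre_nonneg, fun β hβ => ?_⟩
  obtain ⟨ε, hε, hball⟩ := Metric.isOpen_iff.1 isOpen_interior 0 h0
  have hr : 0 < ε / 2 := half_pos hε
  have hεD : ∀ s : ℝ, |s| = ε / 2 → s ∈ effDomain Λ := fun s hs => interior_subset (hball (by
    rw [Metric.mem_ball, Real.dist_eq, sub_zero, hs]; linarith))
  have key : ∀ x s : ℝ, legendre Λ x ≤ β → |s| = ε / 2 → s * x ≤ β + (Λ s).toReal := by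
    intro x s hx hs
    have h1 : ((s * x : ℝ) : EReal) - Λ s ≤ β :=
      (le_iSup (fun θ : ℝ => ((θ * x : ℝ) : EReal) - Λ θ) s).trans hx
    rw [← h.coe_toReal (hεD s hs), ← EReal.coe_sub, EReal.coe_le_coe_iff] at h1
    linarith
  refine (isCompact_Icc (a := -((β + (Λ (-(ε / 2))).toReal) / (ε / 2)))
    (b := (β + (Λ (ε / 2)).toReal) / (ε / 2))).of_isClosed_subset
    (hlsc.isClosed_preimage β) fun x hx => ⟨?_, ?_⟩
  · have := key x (-(ε / 2)) hx (by rw [abs_neg, abs_of_pos hr])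
    rw [neg_le, le_div_iff₀ hr]
    linarith
  · have := key x (ε / 2) hx (abs_of_pos hr)
    rw [le_div_iff₀ hr]
    linarith

/-! ### A one-dimensional Gärtner–Ellis theorem -/

/-- `Λ` is the limiting logarithmic moment generating function of `W t` with speed `t`, stated
through exponential bounds. No lower bound is required outside the effective domain of `Λ`. -/
structure HasLimitingLogMGF {Ω : Type*} [MeasurableSpace Ω] (W : ℝ≥0 → Ω → ℝ) (P : Measure Ω)
    (Λ : ℝ → EReal) : Prop where
  aemeasurable : ∀ t, AEMeasurable (W t) P
  upper : ∀ (θ c : ℝ), Λ θ < c →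
    ∀ᶠ t : ℝ≥0 in atTop, emgf (W t) P θ ≤ ENNReal.ofReal (Real.exp (c * t))
  lower : ∀ θ ∈ effDomain Λ, ∀ c : ℝ, (c : EReal) < Λ θ →
    ∀ᶠ t : ℝ≥0 in atTop, ENNReal.ofReal (Real.exp (c * t)) ≤ emgf (W t) P θ

variable {Ω : Type*} [MeasurableSpace Ω] {P : Measure Ω} {W : ℝ≥0 → Ω → ℝ} {Λ : ℝ → EReal}

theorem HasLimitingLogMGF.neg (h : HasLimitingLogMGF W P Λ) :
    HasLimitingLogMGF (fun t ω => -W t ω) P (fun θ => Λ (-θ)) where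
  aemeasurable t := (h.aemeasurable t).neg
  upper θ c hc := by simpa only [emgf_neg] using h.upper (-θ) c hc
  lower θ hθ c hc := by simpa only [emgf_neg] using h.lower (-θ) hθ c hc

/-- Chernoff's bound. -/
theorem measure_ge_le_emgf {Y : Ω → ℝ} (hY : AEMeasurable Y P) {θ : ℝ} (hθ : 0 ≤ θ) (a : ℝ) :
    P {ω | a ≤ Y ω} ≤ ENNReal.ofReal (Real.exp (-(θ * a))) * emgf Y P θ := by
  have hm : AEMeasurable (fun ω => ENNReal.ofReal (Real.exp (θ * Y ω))) P :=
    (Real.measurable_exp.comp_aemeasurable (hY.const_mul θ)).ennreal_ofReal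
  have h1 := mul_meas_ge_le_lintegral₀ hm (ENNReal.ofReal (Real.exp (θ * a)))
  calc P {ω | a ≤ Y ω}
      ≤ P {ω | ENNReal.ofReal (Real.exp (θ * a)) ≤ ENNReal.ofReal (Real.exp (θ * Y ω))} := by
        refine measure_mono fun ω hω => ?_
        exact ENNReal.ofReal_le_ofReal (Real.exp_le_exp.2 (mul_le_mul_of_nonneg_left hω hθ))
    _ = ENNReal.ofReal (Real.exp (-(θ * a))) * (ENNReal.ofReal (Real.exp (θ * a)) *
        P {ω | ENNReal.ofReal (Real.exp (θ * a)) ≤ ENNReal.ofReal (Real.exp (θ * Y ω))}) := by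
        rw [← mul_assoc, ← ENNReal.ofReal_mul (Real.exp_pos _).le, ← Real.exp_add]
        simp
    _ ≤ _ := by gcongr; exact h1

theorem HasLimitingLogMGF.measure_ge_le [IsProbabilityMeasure P]
    (h : HasLimitingLogMGF W P Λ) (hv : IsValley Λ)
    {a c : ℝ} (ha : 0 ≤ a) (hc : -legendre Λ a < c) :
    ∀ᶠ t : ℝ≥0 in atTop, P {ω | a ≤ W t ω / t} ≤ ENNReal.ofReal (Real.exp (c * t)) := by
  rcases le_or_gt 0 c with hc0 | hc0
  · refine Eventually.of_forall fun t => prob_le_one.trans ?_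
    rw [ENNReal.one_le_ofReal, Real.one_le_exp_iff]
    positivity
  obtain ⟨θ, hθ⟩ := lt_iSup_iff.1 (show ((-c : ℝ) : EReal) < legendre Λ a by
    rw [EReal.coe_neg]; exact EReal.neg_lt_comm.1 hc)
  have hD : θ ∈ effDomain Λ := by
    refine (lt_top_iff_ne_top (a := Λ θ)).2 fun htop => ?_
    simp [htop] at hθ
  rw [← hv.coe_toReal hD, ← EReal.coe_sub, EReal.coe_lt_coe_iff] at hθ
  have hΛ := EReal.toReal_nonneg (hv.nonneg θ)
  have hθ0 : 0 ≤ θ := by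
    by_contra! hneg
    nlinarith [mul_nonneg (neg_nonneg.2 hneg.le) ha]
  have hlt : Λ θ < ((θ * a + c : ℝ) : EReal) := by
    rw [← hv.coe_toReal hD, EReal.coe_lt_coe_iff]
    linarith
  filter_upwards [h.upper θ _ hlt, eventually_pos_atTop] with t ht ht0
  calc P {ω | a ≤ W t ω / t} = P {ω | a * t ≤ W t ω} := by simp_rw [le_div_iff₀ ht0]
    _ ≤ ENNReal.ofReal (Real.exp (-(θ * (a * t)))) * emgf (W t) P θ :=
        measure_ge_le_emgf (h.aemeasurable t) hθ0 _
    _ ≤ ENNReal.ofReal (Real.exp (-(θ * (a * t)))) *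
        ENNReal.ofReal (Real.exp ((θ * a + c) * t)) := by gcongr
    _ = ENNReal.ofReal (Real.exp (c * t)) := by
        rw [← ENNReal.ofReal_mul (Real.exp_pos _).le, ← Real.exp_add]
        ring_nf

theorem HasLimitingLogMGF.measure_inter_Ici_le [IsProbabilityMeasure P]
    (h : HasLimitingLogMGF W P Λ) (hv : IsValley Λ)
    {C : Set ℝ} (hC : IsClosed C) {c : ℝ} (hc : ∀ a ∈ C, -legendre Λ a < c) :
    ∀ᶠ t : ℝ≥0 in atTop,
      P {ω | W t ω / t ∈ C ∩ Ici 0} ≤ ENNReal.ofReal (Real.exp (c * t)) := by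
  rcases (C ∩ Ici 0).eq_empty_or_nonempty with he | hne
  · simp [he]
  have hbdd : BddBelow (C ∩ Ici 0) := ⟨0, fun _ hx => hx.2⟩
  have hmem := (hC.inter isClosed_Ici).csInf_mem hne hbdd
  filter_upwards [h.measure_ge_le hv hmem.2 (hc _ hmem.1)] with t ht
  refine (measure_mono fun ω hω => ?_).trans ht
  exact csInf_le hbdd hω

theorem HasLimitingLogMGF.upper_bound [IsProbabilityMeasure P]
    (h : HasLimitingLogMGF W P Λ) (hv : IsValley Λ)
    {C : Set ℝ} (hC : IsClosed C) :
    limsup (fun t : ℝ≥0 => ENNReal.log (P {ω | W t ω / t ∈ C}) / ((t : ℝ) : EReal)) atTop ≤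
      -⨅ x ∈ C, legendre Λ x := by
  refine limsup_log_div_le fun c hc => ?_
  obtain ⟨c', hc', hcc⟩ := EReal.lt_iff_exists_real_btwn.1 hc
  rw [EReal.coe_lt_coe_iff] at hcc
  have hJ : ∀ a ∈ C, -legendre Λ a < c' := fun a ha =>
    (EReal.neg_le_neg_iff.2 (iInf₂_le a ha)).trans_lt hc'
  have h1 := h.measure_inter_Ici_le hv hC hJ
  have h2 := h.neg.measure_inter_Ici_le hv.neg (hC.preimage continuous_neg) (c := c')
    (fun a ha => by rw [legendre_neg]; exact hJ _ ha)
  filter_upwards [h1, h2, eventually_mul_exp_le 2 hcc] with t ht1 ht2 ht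
  calc P {ω | W t ω / t ∈ C}
      ≤ P ({ω | W t ω / t ∈ C ∩ Ici 0} ∪ {ω | -W t ω / t ∈ Neg.neg ⁻¹' C ∩ Ici 0}) := by
        refine measure_mono fun ω (hω : _ ∈ C) => ?_
        rcases le_total 0 (W t ω / t) with h0 | h0
        · exact Or.inl ⟨hω, h0⟩
        · refine Or.inr ⟨?_, ?_⟩
          · simpa [neg_div] using hω
          · simpa [neg_div] using h0
    _ ≤ ENNReal.ofReal (Real.exp (c' * t)) + ENNReal.ofReal (Real.exp (c' * t)) :=
        (measure_union_le _ _).trans (add_le_add ht1 ht2)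
    _ = ENNReal.ofReal (2 * Real.exp (c' * t)) := by
        rw [← ENNReal.ofReal_add (Real.exp_pos _).le (Real.exp_pos _).le, two_mul]
    _ ≤ _ := ENNReal.ofReal_le_ofReal ht

/-- Splitting the tilted mass: outside the window `|Y - y t| < δ t` the density `exp (θ Y)` is
dominated by the densities tilted by `θ ± r`. -/
theorem emgf_le_window_add_tails {Y : Ω → ℝ} (hY : AEMeasurable Y P) {t r : ℝ} (ht : 0 < t)
    (hr : 0 ≤ r) (θ y δ : ℝ) :
    emgf Y P θ ≤ ENNReal.ofReal (Real.exp ((θ * y + |θ| * δ) * t)) * P {ω | |Y ω / t - y| < δ} +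
      ENNReal.ofReal (Real.exp (-(r * (y + δ) * t))) * emgf Y P (θ + r) +
      ENNReal.ofReal (Real.exp (r * (y - δ) * t)) * emgf Y P (θ - r) := by
  have hm : ∀ s : ℝ, AEMeasurable (fun ω => ENNReal.ofReal (Real.exp (s * Y ω))) P := fun s =>
    (Real.measurable_exp.comp_aemeasurable (hY.const_mul s)).ennreal_ofReal
  set A : Set Ω := {ω | |Y ω / t - y| < δ}
  set K := ENNReal.ofReal (Real.exp ((θ * y + |θ| * δ) * t))
  have hpt : ∀ ω, ENNReal.ofReal (Real.exp (θ * Y ω)) ≤ A.indicator (fun _ => K) ω +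
      ENNReal.ofReal (Real.exp (-(r * (y + δ) * t))) *
        ENNReal.ofReal (Real.exp ((θ + r) * Y ω)) +
      ENNReal.ofReal (Real.exp (r * (y - δ) * t)) *
        ENNReal.ofReal (Real.exp ((θ - r) * Y ω)) := by
    intro ω
    simp_rw [← ENNReal.ofReal_mul (Real.exp_pos _).le, ← Real.exp_add]
    by_cases hω : ω ∈ A
    · refine le_add_of_le_of_nonneg (le_add_of_le_of_nonneg ?_ zero_le) zero_le
      rw [indicator_of_mem hω]
      refine ENNReal.ofReal_le_ofReal (Real.exp_le_exp.2 ?_)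
      have h1 : |Y ω / t - y| ≤ δ := le_of_lt hω
      have h2 : θ * (Y ω / t - y) ≤ |θ| * δ :=
        (le_abs_self _).trans (by rw [abs_mul]; gcongr)
      have h3 : θ * Y ω = (θ * (Y ω / t - y) + θ * y) * t := by field_simp; ring
      rw [h3]
      exact mul_le_mul_of_nonneg_right (by linarith) ht.le
    · have hω' : δ ≤ |Y ω / t - y| := not_lt.1 hω
      rcases le_abs.1 hω' with h1 | h1
      · refine le_add_of_le_of_nonneg (le_add_of_nonneg_of_le zero_le ?_) zero_le
        refine ENNReal.ofReal_le_ofReal (Real.exp_le_exp.2 ?_)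
        have h2 : (y + δ) * t ≤ Y ω := by rw [← le_div_iff₀ ht]; linarith
        nlinarith [mul_le_mul_of_nonneg_left h2 hr]
      · refine le_add_of_nonneg_of_le zero_le ?_
        refine ENNReal.ofReal_le_ofReal (Real.exp_le_exp.2 ?_)
        have h2 : Y ω ≤ (y - δ) * t := by rw [← div_le_iff₀ ht]; linarith
        nlinarith [mul_le_mul_of_nonneg_left h2 hr]
  calc emgf Y P θ ≤ _ := lintegral_mono hpt
    _ = ∫⁻ ω, A.indicator (fun _ => K) ω ∂P +
        ENNReal.ofReal (Real.exp (-(r * (y + δ) * t))) * emgf Y P (θ + r) +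
        ENNReal.ofReal (Real.exp (r * (y - δ) * t)) * emgf Y P (θ - r) := by
        rw [lintegral_add_right' _ ((hm _).const_mul _),
          lintegral_add_right' _ ((hm _).const_mul _),
          lintegral_const_mul'' _ (hm _), lintegral_const_mul'' _ (hm _)]
        rfl
    _ ≤ _ := by
        gcongr
        exact lintegral_indicator_const_le A K

/-- The change-of-measure lower bound at a slope `y` of `Λ`: under the density proportional to
`exp (θ W t)` with `Λ' θ = y`, the variable `W t / t` concentrates around `y`. -/
theorem HasLimitingLogMGF.le_measure_window (h : HasLimitingLogMGF W P Λ) (hv : IsValley Λ)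
    {θ y δ c : ℝ} (hθ : θ ∈ interior (effDomain Λ))
    (hy : HasDerivAt (fun θ => (Λ θ).toReal) y θ) (hδ : 0 < δ)
    (hc : c < (Λ θ).toReal - θ * y - |θ| * δ) :
    ∀ᶠ t : ℝ≥0 in atTop,
      ENNReal.ofReal (Real.exp (c * t)) ≤ P {ω | |W t ω / t - y| < δ} := by
  set g : ℝ → ℝ := fun θ => (Λ θ).toReal with hg
  -- a common step `r` for both tails, from the derivative at `θ`
  obtain ⟨r, hr, hrD, hrD', hr1, hr2⟩ : ∃ r : ℝ, 0 < r ∧ θ + r ∈ effDomain Λ ∧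
      θ - r ∈ effDomain Λ ∧ g (θ + r) - r * (y + δ) < g θ ∧ g (θ - r) + r * (y - δ) < g θ := by
    have hlin := (hasDerivAt_iff_isLittleO.1 hy).def (half_pos hδ)
    have hev := hlin.and (mem_interior_iff_mem_nhds.1 hθ : ∀ᶠ x in 𝓝 θ, x ∈ effDomain Λ)
    obtain ⟨ε, hε, hball⟩ := Metric.eventually_nhds_iff.1 hev
    have hp := hball (y := θ + ε / 2) (by
      rw [Real.dist_eq, add_sub_cancel_left, abs_of_pos (by positivity)]; linarith)
    have hn := hball (y := θ - ε / 2) (by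
      rw [Real.dist_eq, abs_sub_comm, sub_sub_cancel, abs_of_pos (by positivity)]; linarith)
    refine ⟨ε / 2, half_pos hε, hp.2, hn.2, ?_, ?_⟩
    · have := (abs_le.1 hp.1).2
      rw [add_sub_cancel_left, Real.norm_of_nonneg (half_pos hε).le, smul_eq_mul] at this
      nlinarith [mul_pos hδ hε]
    · have := (abs_le.1 hn.1).2
      rw [sub_sub_cancel_left, norm_neg, Real.norm_of_nonneg (half_pos hε).le, smul_eq_mul] at this
      nlinarith [mul_pos hδ hε]
  obtain ⟨m, hm, hmg⟩ := exists_between (max_lt (max_lt hr1 hr2)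
    (show c + θ * y + |θ| * δ < g θ by simp only [hg]; linarith))
  obtain ⟨m', hmm, hmg'⟩ := exists_between hmg
  have hm3 := (le_max_right _ _).trans_lt hm
  have hm1 := ((le_max_left _ _).trans (le_max_left _ _)).trans_lt hm
  have hm2 := ((le_max_right _ _).trans (le_max_left _ _)).trans_lt hm
  have hD := interior_subset hθ
  filter_upwards [h.lower θ hD m' (by rw [← hv.coe_toReal hD]; exact_mod_cast hmg'),
    h.upper (θ + r) (m + r * (y + δ)) (by
      rw [← hv.coe_toReal hrD, EReal.coe_lt_coe_iff]; simp only [hg] at hm1; linarith),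
    h.upper (θ - r) (m - r * (y - δ)) (by
      rw [← hv.coe_toReal hrD', EReal.coe_lt_coe_iff]; simp only [hg] at hm2; linarith),
    eventually_mul_exp_le 3 hmm, eventually_pos_atTop] with t ht1 ht2 ht3 ht4 ht0
  set p := P {ω | |W t ω / t - y| < δ}
  set E := ENNReal.ofReal (Real.exp (m * t)) with hE
  have hsplit : E + E + E ≤
      ENNReal.ofReal (Real.exp ((θ * y + |θ| * δ) * t)) * p + E + E := by
    calc E + E + E = ENNReal.ofReal (3 * Real.exp (m * t)) := by
          rw [hE, ← ENNReal.ofReal_add (by positivity) (by positivity),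
            ← ENNReal.ofReal_add (by positivity) (by positivity)]
          ring_nf
      _ ≤ emgf (W t) P θ := (ENNReal.ofReal_le_ofReal ht4).trans ht1
      _ ≤ _ := emgf_le_window_add_tails (h.aemeasurable t) ht0 hr.le θ y δ
      _ ≤ ENNReal.ofReal (Real.exp ((θ * y + |θ| * δ) * t)) * p +
          ENNReal.ofReal (Real.exp (-(r * (y + δ) * t))) *
            ENNReal.ofReal (Real.exp ((m + r * (y + δ)) * t)) +
          ENNReal.ofReal (Real.exp (r * (y - δ) * t)) *
            ENNReal.ofReal (Real.exp ((m - r * (y - δ)) * t)) := by gcongr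
      _ = _ := by
          simp_rw [← ENNReal.ofReal_mul (Real.exp_pos _).le, ← Real.exp_add]
          rw [hE]
          ring_nf
  have hEtop : E ≠ ⊤ := ENNReal.ofReal_ne_top
  have hEp : E ≤ ENNReal.ofReal (Real.exp ((θ * y + |θ| * δ) * t)) * p :=
    ENNReal.le_of_add_le_add_right hEtop (ENNReal.le_of_add_le_add_right hEtop hsplit)
  calc ENNReal.ofReal (Real.exp (c * t))
      ≤ ENNReal.ofReal (Real.exp (-((θ * y + |θ| * δ) * t))) * E := by
        rw [hE, ← ENNReal.ofReal_mul (Real.exp_pos _).le, ← Real.exp_add]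
        refine ENNReal.ofReal_le_ofReal (Real.exp_le_exp.2 ?_)
        nlinarith
    _ ≤ ENNReal.ofReal (Real.exp (-((θ * y + |θ| * δ) * t))) *
        (ENNReal.ofReal (Real.exp ((θ * y + |θ| * δ) * t)) * p) := by gcongr
    _ = p := by
        rw [← mul_assoc, ← ENNReal.ofReal_mul (Real.exp_pos _).le, ← Real.exp_add]
        simp

/-- The lower bound at a nonnegative point `x` of an open set: move slightly towards the origin, to
a point which is a slope of `Λ`; the rate does not increase. -/
theorem HasLimitingLogMGF.le_measure_open_of_nonneg (h : HasLimitingLogMGF W P Λ)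
    (hv : IsValley Λ) (hs : EssentiallySmooth Λ) (h0 : (0 : ℝ) ∈ interior (effDomain Λ))
    {O : Set ℝ} (hO : IsOpen O) {x c : ℝ} (hxO : x ∈ O) (hx : 0 ≤ x)
    (hc : (c : EReal) < -legendre Λ x) :
    ∀ᶠ t : ℝ≥0 in atTop, ENNReal.ofReal (Real.exp (c * t)) ≤ P {ω | W t ω / t ∈ O} := by
  obtain ⟨y, hyO, hy0, hyx, θ, hθ, hθy⟩ : ∃ y ∈ O, 0 ≤ y ∧ y ≤ x ∧
      ∃ θ ∈ interior (effDomain Λ), deriv (fun θ => (Λ θ).toReal) θ = y := by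
    rcases hx.eq_or_lt with rfl | hx0
    · exact ⟨0, hxO, le_rfl, le_rfl, 0, h0, hv.deriv_zero⟩
    · obtain ⟨ε, hε, hball⟩ := Metric.isOpen_iff.1 hO x hxO
      obtain ⟨y, hy, hyx⟩ := exists_between (max_lt hx0 (sub_lt_self x hε))
      obtain ⟨hy0, hyε⟩ := max_lt_iff.1 hy
      have hfin : legendre Λ x < ⊤ := by
        rw [lt_top_iff_ne_top]
        intro htop
        simp [htop] at hc
      refine ⟨y, hball ?_, hy0.le, hyx.le, hv.exists_deriv_eq hs h0 hy0.le hyx hfin⟩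
      rw [Metric.mem_ball, Real.dist_eq, abs_sub_lt_iff]
      constructor <;> linarith
  have hderiv : HasDerivAt (fun θ => (Λ θ).toReal) y θ :=
    hθy ▸ (hs.differentiable θ hθ).hasDerivAt
  have hlt : c < (Λ θ).toReal - θ * y := by
    have h1 : ((θ * y : ℝ) : EReal) - Λ θ < ((-c : ℝ) : EReal) :=
      ((le_iSup (fun θ : ℝ => ((θ * y : ℝ) : EReal) - Λ θ) θ).trans
        (hv.legendre_le_legendre hy0 hyx)).trans_lt (by
          rw [EReal.coe_neg]; exact EReal.lt_neg_comm.1 hc)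
    rw [← hv.coe_toReal (interior_subset hθ), ← EReal.coe_sub, EReal.coe_lt_coe_iff] at h1
    linarith
  obtain ⟨ε, hε, hball⟩ := Metric.isOpen_iff.1 hO y hyO
  obtain ⟨δ, hδ, hδε, hδc⟩ : ∃ δ > 0, δ ≤ ε ∧ c < (Λ θ).toReal - θ * y - |θ| * δ := by
    refine ⟨min ε (((Λ θ).toReal - θ * y - c) / (|θ| + 1)), ?_, min_le_left _ _, ?_⟩
    · have : 0 < (Λ θ).toReal - θ * y - c := by linarith
      positivity
    · have h1 : min ε (((Λ θ).toReal - θ * y - c) / (|θ| + 1)) * (|θ| + 1) ≤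
          (Λ θ).toReal - θ * y - c := by
        rw [← le_div_iff₀ (by positivity)]; exact min_le_right _ _
      have h2 : 0 < min ε (((Λ θ).toReal - θ * y - c) / (|θ| + 1)) := by
        have : 0 < (Λ θ).toReal - θ * y - c := by linarith
        positivity
      nlinarith
  filter_upwards [h.le_measure_window hv hθ hderiv hδ hδc] with t ht
  refine ht.trans (measure_mono fun ω hω => hball ?_)
  rw [Metric.mem_ball, Real.dist_eq]
  exact lt_of_lt_of_le hω hδε

theorem HasLimitingLogMGF.lower_bound (h : HasLimitingLogMGF W P Λ)
    (hv : IsValley Λ) (hs : EssentiallySmooth Λ) (h0 : (0 : ℝ) ∈ interior (effDomain Λ))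
    {O : Set ℝ} (hO : IsOpen O) :
    -⨅ x ∈ O, legendre Λ x ≤
      liminf (fun t : ℝ≥0 => ENNReal.log (P {ω | W t ω / t ∈ O}) / ((t : ℝ) : EReal)) atTop := by
  refine le_liminf_log_div fun c hc => ?_
  rw [EReal.lt_neg_comm] at hc
  simp only [iInf_lt_iff] at hc
  obtain ⟨x, hxO, hx⟩ := hc
  rw [EReal.lt_neg_comm] at hx
  rcases le_total 0 x with hx0 | hx0
  · exact h.le_measure_open_of_nonneg hv hs h0 hO hxO hx0 hx
  · have := h.neg.le_measure_open_of_nonneg hv.neg hs.neg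
      (by simpa [interior_effDomain_neg] using h0) (hO.preimage continuous_neg) (x := -x) (c := c)
      (by simpa using hxO) (by simpa using hx0) (by rwa [legendre_neg, neg_neg])
    simpa [neg_div] using this

/-- The one-dimensional Gärtner–Ellis theorem, for a limit that is monotone on either side of the
origin. -/
theorem HasLimitingLogMGF.satisfiesLDP [IsProbabilityMeasure P] (h : HasLimitingLogMGF W P Λ)
    (hv : IsValley Λ) (hs : EssentiallySmooth Λ) (h0 : (0 : ℝ) ∈ interior (effDomain Λ)) :
    SatisfiesLDP (fun t ω => W t ω / (t : ℝ)) P (fun t => (t : ℝ)) (legendre Λ) where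
  speed := NNReal.tendsto_coe_atTop.2 tendsto_id
  upper _ hC := h.upper_bound hv hC
  lower _ hO := h.lower_bound hv hs h0 hO

/-! ### Subordinators at random times -/

variable {Ω : Type*} [MeasurableSpace Ω] {P : Measure Ω}

theorem measurable_ofReal_exp (θ : ℝ) :
    Measurable fun x : ℝ => ENNReal.ofReal (Real.exp (θ * x)) := by
  fun_prop

theorem measurable_ofReal_exp_comp {Y : Ω → ℝ} (hY : Measurable Y) (θ : ℝ) :
    Measurable fun ω => ENNReal.ofReal (Real.exp (θ * Y ω)) :=
  (measurable_ofReal_exp θ).comp hY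

theorem emgf_ne_zero [IsProbabilityMeasure P] {Y : Ω → ℝ} (hY : Measurable Y) (θ : ℝ) :
    emgf Y P θ ≠ 0 := by
  rw [emgf, Ne, lintegral_eq_zero_iff (measurable_ofReal_exp_comp hY θ)]
  intro h
  obtain ⟨ω, hω⟩ := h.exists
  exact (ENNReal.ofReal_pos.2 (Real.exp_pos (θ * Y ω))).ne' hω

theorem emgf_add_of_indepFun {X Y : Ω → ℝ} (hX : Measurable X) (hY : Measurable Y)
    (h : IndepFun X Y P) (θ : ℝ) :
    emgf (fun ω => X ω + Y ω) P θ = emgf X P θ * emgf Y P θ := by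
  have hm := measurable_ofReal_exp θ
  have := lintegral_mul_eq_lintegral_mul_lintegral_of_indepFun (hm.comp hX) (hm.comp hY)
    (h.comp hm hm)
  simp only [emgf, mul_add, Real.exp_add, ENNReal.ofReal_mul (Real.exp_pos _).le]
  exact this

theorem IsLevyProcess.emgf_nat [IsProbabilityMeasure P] {X : ℝ≥0 → Ω → ℝ}
    (h : IsLevyProcess X P) (θ : ℝ) (n : ℕ) : emgf (X n) P θ = emgf (X 1) P θ ^ n := by
  induction n with
  | zero =>
    have : emgf (X 0) P θ = emgf (fun _ => 0) P θ :=
      lintegral_congr_ae (h.zero.mono fun ω hω => by simp only [hω])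
    rw [Nat.cast_zero, this]
    simp [emgf]
  | succ n ih =>
    have hind : IndepFun (X n) (X (n + 1) - X n) P :=
      h.indepIncrements.indepFun_eval_sub zero_le (by simp) h.zero
    have hinc : emgf (fun ω => X (n + 1) ω - X n ω) P θ = emgf (X 1) P θ :=
      ((h.stationaryIncrements n 1).comp (measurable_ofReal_exp θ)).lintegral_eq
    have hadd := emgf_add_of_indepFun (h.measurable _)
      ((h.measurable _).sub (h.measurable _)) hind θ
    simp only [Pi.sub_apply, add_sub_cancel] at hadd
    push_cast
    rw [pow_succ, ← ih, ← hinc]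
    exact hadd

theorem measurable_eval_nat {X : ℝ≥0 → Ω → ℝ} (hX : ∀ t, Measurable (X t)) {N : Ω → ℕ}
    (hN : Measurable N) (s : ℕ → ℝ≥0) : Measurable fun ω => X (s (N ω)) ω :=
  (measurable_from_prod_countable_left (f := fun p : Ω × ℕ => X (s p.2) p.1)
    fun n => hX (s n)).comp (measurable_id.prodMk hN)

/-- Conditioning on the independent integer time `N`. -/
theorem IsLevyProcess.emgf_eval_nat [IsProbabilityMeasure P] {X : ℝ≥0 → Ω → ℝ}
    (h : IsLevyProcess X P) {N : Ω → ℕ} (hN : Measurable N)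
    (hind : IndepFun (fun ω t => X t ω) N P) (θ : ℝ) :
    emgf (fun ω => X (N ω) ω) P θ = ∫⁻ ω, emgf (X 1) P θ ^ N ω ∂P := by
  have hm := measurable_ofReal_exp θ
  have hind1 : ∀ n : ℕ, Measurable fun k : ℕ => if k = n then (1 : ℝ≥0∞) else 0 :=
    fun n => measurable_from_top
  have hind2 : ∀ n : ℕ, Measurable fun ω => if N ω = n then (1 : ℝ≥0∞) else 0 :=
    fun n => (hind1 n).comp hN
  have hsplit : ∀ (F : ℕ → Ω → ℝ≥0∞) (ω : Ω),
      F (N ω) ω = ∑' n, F n ω * if N ω = n then (1 : ℝ≥0∞) else 0 := by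
    intro F ω
    rw [tsum_eq_single (N ω) fun n hn => by simp [hn.symm]]
    simp
  calc emgf (fun ω => X (N ω) ω) P θ
      = ∫⁻ ω, ∑' n : ℕ, ENNReal.ofReal (Real.exp (θ * X n ω)) *
          (if N ω = n then (1 : ℝ≥0∞) else 0) ∂P :=
        lintegral_congr fun ω => hsplit (fun n ω => ENNReal.ofReal (Real.exp (θ * X n ω))) ω
    _ = ∑' n : ℕ, ∫⁻ ω, ENNReal.ofReal (Real.exp (θ * X n ω)) *
          (if N ω = n then (1 : ℝ≥0∞) else 0) ∂P :=
        lintegral_tsum fun n =>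
          ((hm.comp (h.measurable n)).mul (hind2 n)).aemeasurable
    _ = ∑' n : ℕ, ∫⁻ ω, emgf (X 1) P θ ^ n * (if N ω = n then (1 : ℝ≥0∞) else 0) ∂P := by
        refine tsum_congr fun n => ?_
        rw [lintegral_const_mul _ (hind2 n), ← h.emgf_nat θ n]
        exact lintegral_mul_eq_lintegral_mul_lintegral_of_indepFun (hm.comp (h.measurable n))
          (hind2 n) (hind.comp (hm.comp (measurable_pi_apply (n : ℝ≥0))) (hind1 n))
    _ = ∫⁻ ω, ∑' n : ℕ, emgf (X 1) P θ ^ n * (if N ω = n then (1 : ℝ≥0∞) else 0) ∂P :=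
        (lintegral_tsum fun n => ((hind2 n).const_mul _).aemeasurable).symm
    _ = _ := lintegral_congr fun ω => (hsplit (fun n _ => emgf (X 1) P θ ^ n) ω).symm

/-- A Lévy process evaluated at a random time is almost everywhere measurable, being the limit of
its values at discretized times decreasing strictly to the given one, by right-continuity. -/
theorem IsLevyProcess.aemeasurable_eval {X : ℝ≥0 → Ω → ℝ} (h : IsLevyProcess X P) {L : Ω → ℝ≥0}
    (hL : Measurable L) : AEMeasurable (fun ω => X (L ω) ω) P := by
  let T : ℕ → ℝ≥0 → ℝ≥0 := fun n l => ((⌊(n + 1) * l⌋₊ : ℝ≥0) + 1) / (n + 1)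
  have hpos : ∀ n : ℕ, (0 : ℝ≥0) < n + 1 := fun n => by positivity
  have hgt : ∀ n l, l < T n l := fun n l => by
    rw [lt_div_iff₀ (hpos n), mul_comm]
    exact Nat.lt_floor_add_one _
  have hle : ∀ n l, T n l ≤ l + 1 / (n + 1) := fun n l => by
    rw [div_le_iff₀ (hpos n), add_mul l, one_div, inv_mul_cancel₀ (hpos n).ne', mul_comm l]
    gcongr
    exact Nat.floor_le zero_le
  have hlim : ∀ l, Tendsto (fun n => T n l) atTop (𝓝[>] l) := fun l => by
    refine tendsto_nhdsWithin_iff.2 ⟨?_, Eventually.of_forall fun n => hgt n l⟩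
    refine tendsto_of_tendsto_of_tendsto_of_le_of_le tendsto_const_nhds ?_ (fun n => (hgt n l).le)
      (fun n => hle n l)
    have : Tendsto (fun n : ℕ => (1 : ℝ≥0) / ((n : ℝ≥0) + 1)) atTop (𝓝 0) :=
      tendsto_one_div_add_atTop_nhds_zero_nat
    simpa using this.const_add l
  refine aemeasurable_of_tendsto_metrizable_ae atTop (f := fun n ω => X (T n (L ω)) ω)
    (fun n => ?_) ?_
  · exact (measurable_eval_nat h.measurable (Nat.measurable_floor.comp (hL.const_mul _))
      (fun k => ((k : ℝ≥0) + 1) / (n + 1))).aemeasurable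
  · filter_upwards [h.cadlag] with ω hω
    exact (hω (L ω)).1.tendsto.comp (hlim (L ω))

theorem IsSubordinator.ae_nonneg {X : ℝ≥0 → Ω → ℝ} (h : IsSubordinator X P) :
    ∀ᵐ ω ∂P, ∀ t, 0 ≤ X t ω := by
  filter_upwards [h.zero, h.monotone] with ω h0 hm t
  exact h0 ▸ hm (zero_le (a := t))

theorem emgf_mono {Y : Ω → ℝ} (hY : ∀ᵐ ω ∂P, 0 ≤ Y ω) : Monotone (emgf Y P) := by
  intro a b hab
  refine lintegral_mono_ae ?_
  filter_upwards [hY] with ω hω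
  gcongr

theorem emgf_zero [IsProbabilityMeasure P] (Y : Ω → ℝ) : emgf Y P 0 = 1 := by
  simp [emgf]

theorem emgf_eq_ofReal_exp [IsProbabilityMeasure P] {Y : Ω → ℝ} (hY : Measurable Y) {θ : ℝ}
    (h : emgf Y P θ ≠ ⊤) : emgf Y P θ = ENNReal.ofReal (Real.exp (logMGF Y P θ).toReal) := by
  rw [← log_emgf, ENNReal.log_pos_real (emgf_ne_zero hY θ) h, EReal.toReal_coe, Real.exp_log
    (ENNReal.toReal_pos (emgf_ne_zero hY θ) h), ENNReal.ofReal_toReal h]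

theorem ofReal_exp_pow (κ : ℝ) (n : ℕ) :
    ENNReal.ofReal (Real.exp κ) ^ n = ENNReal.ofReal (Real.exp (κ * n)) := by
  rw [← ENNReal.ofReal_pow (Real.exp_pos _).le, ← Real.exp_nat_mul, mul_comm]

theorem IsTimeChange.upper {L : ℝ≥0 → Ω → ℝ≥0} {f : ℝ → ℝ} (h : IsTimeChange L f P) {ρ c : ℝ}
    (hc : upsilon f ρ < c) : ∀ᶠ t : ℝ≥0 in atTop,
      emgf (fun ω => (L t ω : ℝ)) P ρ ≤ ENNReal.ofReal (Real.exp (c * t)) := by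
  filter_upwards [(h.tendsto_logMGF ρ).eventually_le_const (EReal.coe_lt_coe_iff.2 hc),
    eventually_pos_atTop] with t ht ht0
  exact (log_div_le_iff ht0).1 ht

theorem IsTimeChange.lower {L : ℝ≥0 → Ω → ℝ≥0} {f : ℝ → ℝ} (h : IsTimeChange L f P) {ρ c : ℝ}
    (hc : c < upsilon f ρ) : ∀ᶠ t : ℝ≥0 in atTop,
      ENNReal.ofReal (Real.exp (c * t)) ≤ emgf (fun ω => (L t ω : ℝ)) P ρ := by
  filter_upwards [(h.tendsto_logMGF ρ).eventually_const_le (EReal.coe_lt_coe_iff.2 hc),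
    eventually_pos_atTop] with t ht ht0
  exact (le_log_div_iff ht0).1 ht

/-! ### The difference of two time-changed subordinators -/

/-- Two subordinators with independent time-changes. The four processes are independent; only the
independence of each subordinator from its time-change, and of the two pairs, is recorded, in a
form that is symmetric in the indices. -/
structure TimeChangedPair (S₁ S₂ : ℝ≥0 → Ω → ℝ) (L₁ L₂ : ℝ≥0 → Ω → ℝ≥0) (f₁ f₂ : ℝ → ℝ)
    (P : Measure Ω) : Prop where
  sub₁ : IsSubordinator S₁ P
  sub₂ : IsSubordinator S₂ P
  time₁ : IsTimeChange L₁ f₁ P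
  time₂ : IsTimeChange L₂ f₂ P
  indep₁ : IndepFun (fun ω t => S₁ t ω) (fun ω t => (L₁ t ω : ℝ)) P
  indep₂ : IndepFun (fun ω t => S₂ t ω) (fun ω t => (L₂ t ω : ℝ)) P
  indep : IndepFun (fun ω => (fun t => S₁ t ω, fun t => (L₁ t ω : ℝ)))
    (fun ω => (fun t => S₂ t ω, fun t => (L₂ t ω : ℝ))) P

variable {S₁ S₂ : ℝ≥0 → Ω → ℝ} {L₁ L₂ : ℝ≥0 → Ω → ℝ≥0} {f₁ f₂ : ℝ → ℝ}

theorem TimeChangedPair.symm (h : TimeChangedPair S₁ S₂ L₁ L₂ f₁ f₂ P) :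
    TimeChangedPair S₂ S₁ L₂ L₁ f₂ f₁ P :=
  ⟨h.sub₂, h.sub₁, h.time₂, h.time₁, h.indep₂, h.indep₁, h.indep.symm⟩

/-- The subordinator at the integer time `⌊L t⌋ + j`, in terms of `L t`. -/
theorem emgf_eval_floor_add [IsProbabilityMeasure P]
    {X : ℝ≥0 → Ω → ℝ} {L : ℝ≥0 → Ω → ℝ≥0} (hX : IsSubordinator X P)
    (hL : ∀ t, Measurable (L t)) (hind : IndepFun (fun ω t => X t ω) (fun ω t => (L t ω : ℝ)) P)
    {θ : ℝ} (hfin : emgf (X 1) P θ ≠ ⊤) (t : ℝ≥0) (j : ℕ) :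
    emgf (fun ω => X ((⌊(L t ω : ℝ)⌋₊ + j : ℕ) : ℝ≥0) ω) P θ =
      ∫⁻ ω, ENNReal.ofReal (Real.exp ((logMGF (X 1) P θ).toReal *
        (⌊(L t ω : ℝ)⌋₊ + j : ℕ))) ∂P := by
  have hfl : Measurable fun l : ℝ≥0 → ℝ => ⌊l t⌋₊ + j :=
    (Nat.measurable_floor.comp (measurable_pi_apply t)).add_const j
  have hN : Measurable fun ω => ⌊(L t ω : ℝ)⌋₊ + j :=
    (Nat.measurable_floor.comp (hL t).coe_nnreal_real).add_const j
  rw [hX.emgf_eval_nat hN (hind.comp measurable_id hfl), emgf_eq_ofReal_exp (hX.measurable 1) hfin]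
  simp_rw [ofReal_exp_pow]

/-- The upper bound for `θ ≥ 0`: drop `S₂ ≥ 0` and round `L₁ t` up. -/
theorem TimeChangedPair.emgf_le [IsProbabilityMeasure P]
    (h : TimeChangedPair S₁ S₂ L₁ L₂ f₁ f₂ P) {θ : ℝ} (hθ : 0 ≤ θ)
    (hfin : emgf (S₁ 1) P θ ≠ ⊤) (hκ : 0 ≤ (logMGF (S₁ 1) P θ).toReal) (t : ℝ≥0) :
    emgf (fun ω => S₁ (L₁ t ω) ω - S₂ (L₂ t ω) ω) P θ ≤
      ENNReal.ofReal (Real.exp (logMGF (S₁ 1) P θ).toReal) *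
        emgf (fun ω => (L₁ t ω : ℝ)) P (logMGF (S₁ 1) P θ).toReal := by
  set κ := (logMGF (S₁ 1) P θ).toReal
  calc emgf (fun ω => S₁ (L₁ t ω) ω - S₂ (L₂ t ω) ω) P θ
      ≤ emgf (fun ω => S₁ ((⌊(L₁ t ω : ℝ)⌋₊ + 1 : ℕ) : ℝ≥0) ω) P θ := by
        refine lintegral_mono_ae ?_
        filter_upwards [h.sub₁.monotone, h.sub₂.ae_nonneg] with ω hm h2
        have h1 : S₁ (L₁ t ω) ω ≤ S₁ ((⌊(L₁ t ω : ℝ)⌋₊ + 1 : ℕ) : ℝ≥0) ω := hm (by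
          have := (Nat.lt_floor_add_one (L₁ t ω : ℝ)).le
          exact_mod_cast this)
        gcongr
        linarith [h2 (L₂ t ω)]
    _ = ∫⁻ ω, ENNReal.ofReal (Real.exp (κ * (⌊(L₁ t ω : ℝ)⌋₊ + 1 : ℕ))) ∂P :=
        emgf_eval_floor_add h.sub₁ h.time₁.measurable h.indep₁ hfin t 1
    _ ≤ ∫⁻ ω, ENNReal.ofReal (Real.exp κ) *
          ENNReal.ofReal (Real.exp (κ * (L₁ t ω : ℝ))) ∂P := by
        refine lintegral_mono fun ω => ?_
        rw [← ENNReal.ofReal_mul (Real.exp_pos _).le, ← Real.exp_add]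
        refine ENNReal.ofReal_le_ofReal (Real.exp_le_exp.2 ?_)
        push_cast
        nlinarith [mul_le_mul_of_nonneg_left (Nat.floor_le (L₁ t ω).coe_nonneg) hκ]
    _ = _ := lintegral_const_mul _
        (measurable_ofReal_exp_comp (h.time₁.measurable t).coe_nnreal_real κ)

/-- The lower bound for `θ ≥ 0`: round `L₁ t` down and `L₂ t` up. -/
theorem TimeChangedPair.le_emgf [IsProbabilityMeasure P]
    (h : TimeChangedPair S₁ S₂ L₁ L₂ f₁ f₂ P) {θ : ℝ} (hθ : 0 ≤ θ)
    (hfin₁ : emgf (S₁ 1) P θ ≠ ⊤) (hfin₂ : emgf (S₂ 1) P (-θ) ≠ ⊤)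
    (hκ₁ : 0 ≤ (logMGF (S₁ 1) P θ).toReal) (hκ₂ : (logMGF (S₂ 1) P (-θ)).toReal ≤ 0) (t : ℝ≥0) :
    ENNReal.ofReal (Real.exp ((logMGF (S₂ 1) P (-θ)).toReal - (logMGF (S₁ 1) P θ).toReal)) *
      (emgf (fun ω => (L₁ t ω : ℝ)) P (logMGF (S₁ 1) P θ).toReal *
        emgf (fun ω => (L₂ t ω : ℝ)) P (logMGF (S₂ 1) P (-θ)).toReal) ≤
      emgf (fun ω => S₁ (L₁ t ω) ω - S₂ (L₂ t ω) ω) P θ := by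
  have he₁ := emgf_eval_floor_add h.sub₁ h.time₁.measurable h.indep₁ hfin₁ t 0
  have he₂ := emgf_eval_floor_add h.sub₂ h.time₂.measurable h.indep₂ hfin₂ t 1
  set κ₁ := (logMGF (S₁ 1) P θ).toReal
  set κ₂ := (logMGF (S₂ 1) P (-θ)).toReal
  have hb₁ : ENNReal.ofReal (Real.exp (-κ₁)) * emgf (fun ω => (L₁ t ω : ℝ)) P κ₁ ≤
      emgf (fun ω => S₁ ((⌊(L₁ t ω : ℝ)⌋₊ + 0 : ℕ) : ℝ≥0) ω) P θ := by
    rw [he₁, emgf, ← lintegral_const_mul _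
      (measurable_ofReal_exp_comp (h.time₁.measurable t).coe_nnreal_real κ₁)]
    refine lintegral_mono fun ω => ?_
    rw [← ENNReal.ofReal_mul (Real.exp_pos _).le, ← Real.exp_add]
    refine ENNReal.ofReal_le_ofReal (Real.exp_le_exp.2 ?_)
    push_cast
    nlinarith [mul_le_mul_of_nonneg_left (Nat.lt_floor_add_one (L₁ t ω : ℝ)).le hκ₁]
  have hb₂ : ENNReal.ofReal (Real.exp κ₂) * emgf (fun ω => (L₂ t ω : ℝ)) P κ₂ ≤
      emgf (fun ω => S₂ ((⌊(L₂ t ω : ℝ)⌋₊ + 1 : ℕ) : ℝ≥0) ω) P (-θ) := by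
    rw [he₂, emgf, ← lintegral_const_mul _
      (measurable_ofReal_exp_comp (h.time₂.measurable t).coe_nnreal_real κ₂)]
    refine lintegral_mono fun ω => ?_
    rw [← ENNReal.ofReal_mul (Real.exp_pos _).le, ← Real.exp_add]
    refine ENNReal.ofReal_le_ofReal (Real.exp_le_exp.2 ?_)
    push_cast
    nlinarith [mul_le_mul_of_nonpos_left (Nat.floor_le (L₂ t ω).coe_nonneg) hκ₂]
  -- both factors are measurable functionals of the path pairs `(Sᵢ, Lᵢ)`
  have hev : ∀ j : ℕ, Measurable fun p : (ℝ≥0 → ℝ) × (ℝ≥0 → ℝ) => p.1 ((⌊p.2 t⌋₊ + j : ℕ) : ℝ≥0) :=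
    fun j => measurable_eval_nat (Ω := (ℝ≥0 → ℝ) × (ℝ≥0 → ℝ)) (X := fun s p => p.1 s)
      (fun s => (measurable_pi_apply s).comp measurable_fst)
      ((Nat.measurable_floor.comp ((measurable_pi_apply t).comp measurable_snd)).add_const j)
      (fun n => (n : ℝ≥0))
  have hY₁ : Measurable fun ω => S₁ ((⌊(L₁ t ω : ℝ)⌋₊ + 0 : ℕ) : ℝ≥0) ω :=
    measurable_eval_nat h.sub₁.measurable
      ((Nat.measurable_floor.comp (h.time₁.measurable t).coe_nnreal_real).add_const 0)
      (fun n => (n : ℝ≥0))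
  have hY₂ : Measurable fun ω => S₂ ((⌊(L₂ t ω : ℝ)⌋₊ + 1 : ℕ) : ℝ≥0) ω :=
    measurable_eval_nat h.sub₂.measurable
      ((Nat.measurable_floor.comp (h.time₂.measurable t).coe_nnreal_real).add_const 1)
      (fun n => (n : ℝ≥0))
  have hindY := h.indep.comp (hev 0) (hev 1).neg
  calc _ = (ENNReal.ofReal (Real.exp (-κ₁)) * emgf (fun ω => (L₁ t ω : ℝ)) P κ₁) *
        (ENNReal.ofReal (Real.exp κ₂) * emgf (fun ω => (L₂ t ω : ℝ)) P κ₂) := by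
        rw [sub_eq_neg_add, Real.exp_add, ENNReal.ofReal_mul (Real.exp_pos _).le]
        ring
    _ ≤ emgf (fun ω => S₁ ((⌊(L₁ t ω : ℝ)⌋₊ + 0 : ℕ) : ℝ≥0) ω) P θ *
        emgf (fun ω => -S₂ ((⌊(L₂ t ω : ℝ)⌋₊ + 1 : ℕ) : ℝ≥0) ω) P θ := by
        rw [emgf_neg]
        exact mul_le_mul' hb₁ hb₂
    _ = emgf (fun ω => S₁ ((⌊(L₁ t ω : ℝ)⌋₊ + 0 : ℕ) : ℝ≥0) ω +
        -S₂ ((⌊(L₂ t ω : ℝ)⌋₊ + 1 : ℕ) : ℝ≥0) ω) P θ :=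
        (emgf_add_of_indepFun hY₁ hY₂.neg hindY θ).symm
    _ ≤ _ := by
        refine lintegral_mono_ae ?_
        filter_upwards [h.sub₁.monotone, h.sub₂.monotone] with ω hm₁ hm₂
        have h1 : S₁ ((⌊(L₁ t ω : ℝ)⌋₊ + 0 : ℕ) : ℝ≥0) ω ≤ S₁ (L₁ t ω) ω := hm₁ (by
          have := Nat.floor_le (L₁ t ω).coe_nonneg
          exact_mod_cast this)
        have h2 : S₂ (L₂ t ω) ω ≤ S₂ ((⌊(L₂ t ω : ℝ)⌋₊ + 1 : ℕ) : ℝ≥0) ω := hm₂ (by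
          have := (Nat.lt_floor_add_one (L₂ t ω : ℝ)).le
          exact_mod_cast this)
        gcongr
        linarith

/-! ### The limiting logarithmic moment generating function of the difference -/

theorem logMGF_nonneg [IsProbabilityMeasure P]
    {X : ℝ≥0 → Ω → ℝ} (hX : IsSubordinator X P) {θ : ℝ} (hθ : 0 ≤ θ) :
    0 ≤ logMGF (X 1) P θ := by
  rw [← log_emgf, ENNReal.zero_le_log_iff, ← emgf_zero (P := P) (X 1)]
  exact emgf_mono (hX.ae_nonneg.mono fun ω h => h 1) hθ

theorem logMGF_nonpos [IsProbabilityMeasure P]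
    {X : ℝ≥0 → Ω → ℝ} (hX : IsSubordinator X P) {θ : ℝ} (hθ : θ ≤ 0) :
    logMGF (X 1) P θ ≤ 0 := by
  rw [← log_emgf, ENNReal.log_le_zero_iff, ← emgf_zero (P := P) (X 1)]
  exact emgf_mono (hX.ae_nonneg.mono fun ω h => h 1) hθ

theorem Psi_of_nonneg {θ : ℝ} (hθ : 0 ≤ θ) :
    Psi f₁ f₂ S₁ S₂ P θ = extendTop f₁ (logMGF (S₁ 1) P θ) := if_pos hθ

theorem logMGF_zero [IsProbabilityMeasure P]
    (Y : Ω → ℝ) : logMGF Y P 0 = 0 := by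
  rw [← log_emgf, emgf_zero, ENNReal.log_one]

theorem TimeChangedPair.Psi_zero [IsProbabilityMeasure P]
    (h : TimeChangedPair S₁ S₂ L₁ L₂ f₁ f₂ P) :
    Psi f₁ f₂ S₁ S₂ P 0 = 0 := by
  rw [Psi_of_nonneg le_rfl, logMGF_zero]
  simp [extendTop, h.time₁.map_zero]

theorem TimeChangedPair.Psi_neg [IsProbabilityMeasure P]
    (h : TimeChangedPair S₁ S₂ L₁ L₂ f₁ f₂ P) (θ : ℝ) :
    Psi f₁ f₂ S₁ S₂ P (-θ) = Psi f₂ f₁ S₂ S₁ P θ := by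
  rcases lt_trichotomy θ 0 with hθ | rfl | hθ
  · simp [Psi, hθ.le, not_le.2 hθ]
  · rw [neg_zero, h.Psi_zero, h.symm.Psi_zero]
  · simp [Psi, hθ.le, not_le.2 hθ]

theorem TimeChangedPair.monotoneOn_Psi [IsProbabilityMeasure P]
    (h : TimeChangedPair S₁ S₂ L₁ L₂ f₁ f₂ P) :
    MonotoneOn (Psi f₁ f₂ S₁ S₂ P) (Ici 0) := by
  intro a ha b hb hab
  rw [Psi_of_nonneg ha, Psi_of_nonneg hb]
  have hle : logMGF (S₁ 1) P a ≤ logMGF (S₁ 1) P b :=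
    ENNReal.log_monotone (emgf_mono (h.sub₁.ae_nonneg.mono fun ω h => h 1) hab)
  have ha0 := logMGF_nonneg h.sub₁ ha
  have hb0 := logMGF_nonneg h.sub₁ hb
  unfold extendTop
  by_cases hbt : logMGF (S₁ 1) P b = ⊤
  · simp [hbt]
  · have hat : logMGF (S₁ 1) P a ≠ ⊤ := fun hat => hbt (top_le_iff.1 (hat ▸ hle))
    rw [if_neg hat, if_neg hbt, EReal.coe_le_coe_iff]
    exact h.time₁.monotone (EReal.toReal_nonneg ha0) (EReal.toReal_nonneg hb0)
      (EReal.toReal_le_toReal hle (ne_bot_of_le_ne_bot EReal.zero_ne_bot ha0) hbt)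

theorem TimeChangedPair.isValley [IsProbabilityMeasure P]
    (h : TimeChangedPair S₁ S₂ L₁ L₂ f₁ f₂ P) :
    IsValley (Psi f₁ f₂ S₁ S₂ P) where
  map_zero := h.Psi_zero
  monotoneOn := h.monotoneOn_Psi
  antitoneOn a ha b hb hab := by
    rw [← h.symm.Psi_neg, ← h.symm.Psi_neg]
    exact h.symm.monotoneOn_Psi (by simpa using hb) (by simpa using ha) (by simpa)

theorem TimeChangedPair.upper_of_nonneg [IsProbabilityMeasure P]
    (h : TimeChangedPair S₁ S₂ L₁ L₂ f₁ f₂ P) {θ c : ℝ}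
    (hθ : 0 ≤ θ) (hc : Psi f₁ f₂ S₁ S₂ P θ < c) : ∀ᶠ t : ℝ≥0 in atTop,
      emgf (fun ω => S₁ (L₁ t ω) ω - S₂ (L₂ t ω) ω) P θ ≤ ENNReal.ofReal (Real.exp (c * t)) := by
  rw [Psi_of_nonneg hθ, extendTop] at hc
  split_ifs at hc with htop
  · simp at hc
  have hκ := EReal.toReal_nonneg (logMGF_nonneg h.sub₁ hθ)
  obtain ⟨c', hc', hcc⟩ := exists_between (EReal.coe_lt_coe_iff.1 hc)
  have hfin : emgf (S₁ 1) P θ ≠ ⊤ := fun hf => htop (ENNReal.log_eq_top_iff.2 hf)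
  filter_upwards [h.time₁.upper (c := c') (by rwa [upsilon, if_pos hκ]),
    eventually_mul_exp_le (Real.exp (logMGF (S₁ 1) P θ).toReal) hcc] with t ht1 ht2
  calc _ ≤ _ := h.emgf_le hθ hfin hκ t
    _ ≤ ENNReal.ofReal (Real.exp (logMGF (S₁ 1) P θ).toReal) *
        ENNReal.ofReal (Real.exp (c' * t)) := by gcongr
    _ ≤ _ := by
        rw [← ENNReal.ofReal_mul (Real.exp_pos _).le]
        exact ENNReal.ofReal_le_ofReal ht2

theorem TimeChangedPair.lower_of_nonneg [IsProbabilityMeasure P]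
    (h : TimeChangedPair S₁ S₂ L₁ L₂ f₁ f₂ P) {θ c : ℝ}
    (hθ : 0 ≤ θ) (hD : Psi f₁ f₂ S₁ S₂ P θ < ⊤) (hc : (c : EReal) < Psi f₁ f₂ S₁ S₂ P θ) :
    ∀ᶠ t : ℝ≥0 in atTop, ENNReal.ofReal (Real.exp (c * t)) ≤
      emgf (fun ω => S₁ (L₁ t ω) ω - S₂ (L₂ t ω) ω) P θ := by
  rw [Psi_of_nonneg hθ, extendTop] at hc hD
  split_ifs at hc hD with htop
  · simp at hD
  rw [EReal.coe_lt_coe_iff] at hc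
  have hκ₁ := EReal.toReal_nonneg (logMGF_nonneg h.sub₁ hθ)
  have hκ₂ := EReal.toReal_nonpos (logMGF_nonpos h.sub₂ (neg_nonpos.2 hθ))
  have hfin₁ : emgf (S₁ 1) P θ ≠ ⊤ := fun hf => htop (ENNReal.log_eq_top_iff.2 hf)
  have hfin₂ : emgf (S₂ 1) P (-θ) ≠ ⊤ :=
    ne_top_of_le_ne_top ENNReal.one_ne_top
      (ENNReal.log_le_zero_iff.1 (logMGF_nonpos h.sub₂ (neg_nonpos.2 hθ)))
  have hu₂ : upsilon f₂ (logMGF (S₂ 1) P (-θ)).toReal = 0 := by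
    unfold upsilon
    split_ifs with h0
    · rw [le_antisymm hκ₂ h0, h.time₂.map_zero]
    · rfl
  have hcl := h.le_emgf hθ hfin₁ hfin₂ hκ₁ hκ₂
  set κ₁ := (logMGF (S₁ 1) P θ).toReal
  set κ₂ := (logMGF (S₂ 1) P (-θ)).toReal
  obtain ⟨c₁, hcc₁, hc₁⟩ := exists_between hc
  obtain ⟨c', hcc', hc'⟩ := exists_between hcc₁
  filter_upwards [h.time₁.lower (ρ := κ₁) (c := c₁) (by rwa [upsilon, if_pos hκ₁]),
    h.time₂.lower (ρ := κ₂) (c := c' - c₁) (by rw [hu₂]; linarith),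
    eventually_mul_exp_le (Real.exp (-(κ₂ - κ₁))) hcc'] with t ht1 ht2 ht3
  calc ENNReal.ofReal (Real.exp (c * t))
      ≤ ENNReal.ofReal (Real.exp (κ₂ - κ₁)) * (ENNReal.ofReal (Real.exp (c₁ * t)) *
        ENNReal.ofReal (Real.exp ((c' - c₁) * t))) := by
        simp_rw [← ENNReal.ofReal_mul (Real.exp_pos _).le, ← Real.exp_add] at ht3 ⊢
        rw [Real.exp_le_exp] at ht3
        refine ENNReal.ofReal_le_ofReal (Real.exp_le_exp.2 ?_)
        linarith
    _ ≤ _ := by gcongr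
    _ ≤ _ := hcl t

theorem TimeChangedPair.hasLimitingLogMGF [IsProbabilityMeasure P]
    (h : TimeChangedPair S₁ S₂ L₁ L₂ f₁ f₂ P) :
    HasLimitingLogMGF (fun t ω => S₁ (L₁ t ω) ω - S₂ (L₂ t ω) ω) P (Psi f₁ f₂ S₁ S₂ P) := by
  have hswap : ∀ (t : ℝ≥0) (θ : ℝ), emgf (fun ω => S₂ (L₂ t ω) ω - S₁ (L₁ t ω) ω) P (-θ) =
      emgf (fun ω => S₁ (L₁ t ω) ω - S₂ (L₂ t ω) ω) P θ := fun t θ => by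
    simp_rw [← emgf_neg, neg_sub]
  refine ⟨fun t => (h.sub₁.aemeasurable_eval (h.time₁.measurable t)).sub
    (h.sub₂.aemeasurable_eval (h.time₂.measurable t)), fun θ c hc => ?_, fun θ hD c hc => ?_⟩
  · rcases le_total 0 θ with hθ | hθ
    · exact h.upper_of_nonneg hθ hc
    · rw [← h.symm.Psi_neg] at hc
      simpa only [hswap] using h.symm.upper_of_nonneg (neg_nonneg.2 hθ) hc
  · rcases le_total 0 θ with hθ | hθ
    · exact h.lower_of_nonneg hθ hD hc
    · have hD' : Psi f₁ f₂ S₁ S₂ P θ < ⊤ := hD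
      rw [← h.symm.Psi_neg] at hc hD'
      simpa only [hswap] using h.symm.lower_of_nonneg (neg_nonneg.2 hθ) hD' hc

theorem TimeChangedPair.emgf_sub_one (h : TimeChangedPair S₁ S₂ L₁ L₂ f₁ f₂ P) (θ : ℝ) :
    emgf (fun ω => S₁ 1 ω - S₂ 1 ω) P θ = emgf (S₁ 1) P θ * emgf (S₂ 1) P (-θ) := by
  have hev : Measurable fun p : (ℝ≥0 → ℝ) × (ℝ≥0 → ℝ) => p.1 1 :=
    (measurable_pi_apply 1).comp measurable_fst
  rw [← emgf_neg]
  simp_rw [sub_eq_add_neg]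
  exact emgf_add_of_indepFun (h.sub₁.measurable 1) (h.sub₂.measurable 1).neg
    (h.indep.comp hev hev.neg) θ

theorem TimeChangedPair.mem_effDomain [IsProbabilityMeasure P]
    (h : TimeChangedPair S₁ S₂ L₁ L₂ f₁ f₂ P) {θ : ℝ}
    (hθ : 0 ≤ θ) (hfin : emgf (fun ω => S₁ 1 ω - S₂ 1 ω) P θ < ⊤) :
    θ ∈ effDomain (Psi f₁ f₂ S₁ S₂ P) := by
  rw [h.emgf_sub_one] at hfin
  have hfin₁ : emgf (S₁ 1) P θ ≠ ⊤ := fun htop => by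
    rw [htop, ENNReal.top_mul (emgf_ne_zero (h.sub₂.measurable 1) _)] at hfin
    exact hfin.false
  have hne : logMGF (S₁ 1) P θ ≠ ⊤ := fun htop => hfin₁ (ENNReal.log_eq_top_iff.1 htop)
  change Psi f₁ f₂ S₁ S₂ P θ < ⊤
  rw [Psi_of_nonneg hθ, extendTop, if_neg hne]
  exact EReal.coe_lt_top _

theorem TimeChangedPair.zero_mem_interior [IsProbabilityMeasure P]
    (h : TimeChangedPair S₁ S₂ L₁ L₂ f₁ f₂ P)
    (hfin : ∀ᶠ θ in 𝓝 (0 : ℝ), emgf (fun ω => S₁ 1 ω - S₂ 1 ω) P θ < ⊤) :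
    (0 : ℝ) ∈ interior (effDomain (Psi f₁ f₂ S₁ S₂ P)) := by
  rw [mem_interior_iff_mem_nhds]
  filter_upwards [hfin] with θ hθ
  rcases le_total 0 θ with h0 | h0
  · exact h.mem_effDomain h0 hθ
  · have h1 : -θ ∈ effDomain (Psi f₂ f₁ S₂ S₁ P) := by
      refine h.symm.mem_effDomain (neg_nonneg.2 h0) ?_
      rw [← emgf_neg]
      simpa only [neg_sub] using hθ
    change Psi f₂ f₁ S₂ S₁ P (-θ) < ⊤ at h1
    rwa [h.symm.Psi_neg] at h1

end TimeChangeLDP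

theorem mainTheorem11 {Ω₀ Ω : Type*} [MeasurableSpace Ω₀] [MeasurableSpace Ω]
    (P₀ : Measure Ω₀) [IsProbabilityMeasure P₀] (P : Measure Ω) [IsProbabilityMeasure P]
    -- the light-tailed Lévy process `S`, of bounded variation and not a subordinator
    (S : ℝ≥0 → Ω₀ → ℝ)
    (hS : TimeChangeLDP.IsLevyProcess S P₀)
    (hS_light : TimeChangeLDP.IsLightTailed S P₀)
    (hS_bv : TimeChangeLDP.HasBVPaths S P₀)
    (hS_not_sub : ¬ TimeChangeLDP.IsSubordinator S P₀)
    -- non-null subordinators `S₁`, `S₂` such that `S` is distributed as `S₁ - S₂`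
    (S₁ S₂ : ℝ≥0 → Ω → ℝ)
    (hS₁ : TimeChangeLDP.IsSubordinator S₁ P) (hS₁_null : ¬ TimeChangeLDP.IsNull S₁ P)
    (hS₂ : TimeChangeLDP.IsSubordinator S₂ P) (hS₂_null : ¬ TimeChangeLDP.IsNull S₂ P)
    (hS_law : IdentDistrib (fun ω t => S t ω) (fun ω t => S₁ t ω - S₂ t ω) P₀ P)
    -- the random time-changes
    (f₁ f₂ : ℝ → ℝ) (L₁ L₂ : ℝ≥0 → Ω → ℝ≥0)
    (hL₁ : TimeChangeLDP.IsTimeChange L₁ f₁ P) (hL₂ : TimeChangeLDP.IsTimeChange L₂ f₂ P)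
    -- the four processes are independent
    (h_indep : iIndepFun (β := fun _ : Fin 4 => ℝ≥0 → ℝ)
      ![fun ω t => S₁ t ω, fun ω t => S₂ t ω, fun ω t => (L₁ t ω : ℝ), fun ω t => (L₂ t ω : ℝ)] P)
    (h_smooth : TimeChangeLDP.EssentiallySmooth (TimeChangeLDP.Psi f₁ f₂ S₁ S₂ P)) :
    TimeChangeLDP.IsGoodRateFunction
        (TimeChangeLDP.legendre (TimeChangeLDP.Psi f₁ f₂ S₁ S₂ P)) ∧
      TimeChangeLDP.SatisfiesLDP
        (fun t ω => (S₁ (L₁ t ω) ω - S₂ (L₂ t ω) ω) / (t : ℝ)) P (fun t => (t : ℝ))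
        (TimeChangeLDP.legendre (TimeChangeLDP.Psi f₁ f₂ S₁ S₂ P)) := by
  have hmeas : ∀ i, Measurable ((![fun ω t => S₁ t ω, fun ω t => S₂ t ω,
      fun ω t => (L₁ t ω : ℝ), fun ω t => (L₂ t ω : ℝ)] : Fin 4 → Ω → ℝ≥0 → ℝ) i) := by
    intro i
    fin_cases i
    · exact measurable_pi_lambda _ hS₁.measurable
    · exact measurable_pi_lambda _ hS₂.measurable
    · exact measurable_pi_lambda _ fun t => (hL₁.measurable t).coe_nnreal_real
    · exact measurable_pi_lambda _ fun t => (hL₂.measurable t).coe_nnreal_real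
  have hpair : TimeChangeLDP.TimeChangedPair S₁ S₂ L₁ L₂ f₁ f₂ P :=
    { sub₁ := hS₁, sub₂ := hS₂, time₁ := hL₁, time₂ := hL₂
      indep₁ := h_indep.indepFun (i := 0) (j := 2) (by decide)
      indep₂ := h_indep.indepFun (i := 1) (j := 3) (by decide)
      indep := h_indep.indepFun_prodMk_prodMk hmeas 0 2 1 3
        (by decide) (by decide) (by decide) (by decide) }
  have h0 : (0 : ℝ) ∈ interior (TimeChangeLDP.effDomain (TimeChangeLDP.Psi f₁ f₂ S₁ S₂ P)) := by
    refine hpair.zero_mem_interior ?_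
    filter_upwards [hS_light] with θ hθ
    have heq : TimeChangeLDP.emgf (S 1) P₀ θ =
        TimeChangeLDP.emgf (fun ω => S₁ 1 ω - S₂ 1 ω) P θ :=
      (hS_law.comp ((TimeChangeLDP.measurable_ofReal_exp θ).comp
        (measurable_pi_apply (1 : ℝ≥0)))).lintegral_eq
    rw [← heq]
    exact ENNReal.log_lt_top_iff.1 hθ
  exact ⟨hpair.isValley.isGoodRateFunction h0,
    hpair.hasLimitingLogMGF.satisfiesLDP hpair.isValley h_smooth h0⟩
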